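/- Let $G=(V,E)$ be an undirected graph with $p$ vertices (no loops) and let $\sigma:V\to\{1,\dots,p\}$ be an ordering (a bijection). Write $i\sim j$ if $\{\sigma^{-1}(i),\sigma^{-1}(j)\}\in E$. Let $\mathbb P_{G_\sigma}$ be the cone of symmetric positive definite real $p\times p$ matrices $\Omega$ with $\Omega_{ij}=0$ whenever $i\ne j$ and $i\not\sim j$, and let $d\Omega$ be Lebesgue measure in the free entries $\Omega_{ij}$ ($i\ge j$, with $i=j$ or $i\sim j$). Every positive definite $\Omega$ has a unique decomposition $\Omega=LDL^{T}$ with $L$ lower triangular with unit diagonal and $D$ diagonal with positive diagonal entries $D_{ii}(\Omega)$. Let $U$ be a symmetric positive definite real $p\times p$ matrix and let $\delta_1,\dots,\delta_p>4$. The generalized $G$-Wishart distribution with parameters $(U,\delta)$ is the distribution on $\mathbb P_{G_\sigma}$ whose density with respect to $d\Omega$ is proportional to $$\Big(\prod_{i=1}^p D_{ii}(\Omega)^{\delta_i/2}\Big)\exp\Big(-\tfrac12\operatorname{tr}(\Omega U)\Big).$$ For $1\le k\le p$ let $\Omega_k$ be the leading $k\times k$ principal submatrix of $\Omega$, let $[\Omega_k^{-1}]^0$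 be the $p\times p$ matrix that has $\Omega_k^{-1}$ as its leading $k\times k$ block and zeros elsewhere, and put $\delta_{p+1}=0$. For a $p\times p$ matrix $A$ let $A_{G_\sigma}$ be the matrix with $(A_{G_\sigma})_{ij}=A_{ij}$ if $i=j$ or $i\sim j$, and $(A_{G_\sigma})_{ij}=0$ otherwise. Then this density can be normalized to a probability density. If $\Omega$ has the generalized $G$-Wishart distribution with parameters $(U,\delta)$ and $$\Sigma^*=\sum_{k=1}^p(\delta_k-\delta_{k+1})\,[\Omega_k^{-1}]^0,$$ then all entries of $\Sigma^*$ are integrable, and $$\big(E[\Sigma^*]\big)_{G_\sigma}=U_{G_\sigma},$$ that is, $E[\Sigma^*_{ij}]=U_{ij}$ whenever $i=j$ or $i\sim j$. In particular, if all $\delta_k$ are equal to one number $\delta$, then $(\Omega^{-1})_{ij}$ is integrable and $E[(\Omega^{-1})_{ij}]=U_{ij}/\delta$ whenever $i=j$ or $i\sim j$. -/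

import Mathlib

open MeasureTheory ProbabilityTheory Matrix

noncomputable section

/-- The ordered graph `G_σ` on `{0, …, p - 1}`: `i` and `j` are adjacent iff `σ⁻¹ i` and `σ⁻¹ j`
are adjacent in `G`. -/
def orderedGraph {V : Type*} {p : ℕ} (G : SimpleGraph V) (σ : V ≃ Fin p) :
    SimpleGraph (Fin p) :=
  G.comap σ.symm

/-- The cone of symmetric positive definite matrices `Ω` whose off-diagonal entry `Ω i j` vanishes
whenever `i` and `j` are not adjacent in `H`. -/
def PDCone {p : ℕ} (H : SimpleGraph (Fin p)) : Set (Matrix (Fin p) (Fin p) ℝ) :=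
  {Ω | Ω.PosDef ∧ ∀ i j, i ≠ j → ¬ H.Adj i j → Ω i j = 0}

/-- `Ω = L D Lᵀ` is the modified Cholesky decomposition of `Ω`: `L` is lower triangular with unit
diagonal, and `D` is diagonal with positive diagonal entries `d`. -/
structure IsModifiedCholesky {p : ℕ} (Ω L : Matrix (Fin p) (Fin p) ℝ) (d : Fin p → ℝ) :
    Prop where
  lower : ∀ i j, i < j → L i j = 0
  unit_diag : ∀ i, L i i = 1
  pos : ∀ i, 0 < d i
  eq : Ω = L * Matrix.diagonal d * Lᵀ

open Classical in
/-- The diagonal entries `D_ii(Ω)` of the modified Cholesky decomposition (and `0` for a matrix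
that has none). -/
def choleskyD {p : ℕ} (Ω : Matrix (Fin p) (Fin p) ℝ) : Fin p → ℝ :=
  if h : ∃ d : Fin p → ℝ, ∃ L, IsModifiedCholesky Ω L d then h.choose else 0

/-- Every positive definite matrix has a modified Cholesky decomposition, -/
theorem exists_isModifiedCholesky {p : ℕ} {Ω : Matrix (Fin p) (Fin p) ℝ} (hΩ : Ω.PosDef) :
    ∃ d : Fin p → ℝ, ∃ L, IsModifiedCholesky Ω L d := by
  have hB : Matrix.BlockTriangular (LDL.lower hΩ) OrderDual.toDual :=
    Matrix.blockTriangular_inv_of_blockTriangular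
      (fun i j hij => LDL.lowerInv_triangular hΩ hij)
  have hdet : (LDL.lower hΩ).det ≠ 0 := by
    have h := Matrix.isUnit_det_of_invertible (LDL.lowerInv hΩ)
    have h2 := Matrix.isUnit_nonsing_inv_det _ h
    exact h2.ne_zero
  have he : ∀ i, LDL.lower hΩ i i ≠ 0 := by
    rw [Matrix.det_of_isLowerTriangular _ hB] at hdet
    exact fun i => Finset.prod_ne_zero_iff.1 hdet i (Finset.mem_univ i)
  have hpos : ∀ i, 0 < LDL.diagEntries hΩ i := by
    have h : (LDL.diag hΩ).PosDef := by
      rw [LDL.diag_eq_lowerInv_conj]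
      exact hΩ.mul_mul_conjTranspose_same
        (Matrix.vecMul_injective_of_isUnit (isUnit_of_invertible (LDL.lowerInv hΩ)))
    exact Matrix.posDef_diagonal_iff.1 h
  refine ⟨fun j => LDL.diagEntries hΩ j * LDL.lower hΩ j j ^ 2,
    LDL.lower hΩ * Matrix.diagonal (fun j => (LDL.lower hΩ j j)⁻¹), ?_, ?_, ?_, ?_⟩
  · intro i j hij
    rw [Matrix.mul_diagonal, hB (by exact hij), zero_mul]
  · intro i
    rw [Matrix.mul_diagonal, mul_inv_cancel₀ (he i)]
  · intro i
    have := he i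
    have := hpos i
    positivity
  · conv_lhs => rw [← LDL.lower_conj_diag hΩ]
    rw [Matrix.transpose_mul, Matrix.diagonal_transpose, LDL.diag]
    simp only [Matrix.mul_assoc, Matrix.conjTranspose_eq_transpose_of_trivial]
    rw [← Matrix.mul_assoc (Matrix.diagonal _) (Matrix.diagonal _) (_ᵀ),
      ← Matrix.mul_assoc (Matrix.diagonal _) (Matrix.diagonal _ * _) (_ᵀ),
      Matrix.diagonal_mul_diagonal, Matrix.diagonal_mul_diagonal]
    congr 3
    ext i
    have := he i
    field_simp

/-- and the diagonal part is determined by the matrix. -/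
theorem IsModifiedCholesky.choleskyD_eq {p : ℕ} {Ω L : Matrix (Fin p) (Fin p) ℝ}
    {d : Fin p → ℝ} (h : IsModifiedCholesky Ω L d) : choleskyD Ω = d := by
  have key : ∀ (M : Matrix (Fin p) (Fin p) ℝ) (e : Fin p → ℝ), IsModifiedCholesky Ω M e →
      ∀ i j, Ω i j = ∑ k ∈ Finset.univ.filter (· < j), M i k * e k * M j k + M i j * e j := by
    intro M e h i j
    have h1 : Ω i j = ∑ k, M i k * e k * M j k := by
      conv_lhs => rw [h.eq]
      rw [Matrix.mul_apply]
      simp only [Matrix.mul_diagonal, Matrix.transpose_apply]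
    rw [h1, ← Finset.sum_filter_add_sum_filter_not Finset.univ (· < j)]
    congr 1
    rw [Finset.sum_eq_single j]
    · rw [h.unit_diag, mul_one]
    · intro k hk hkj
      rw [h.lower j k (lt_of_le_of_ne (not_lt.1 (Finset.mem_filter.1 hk).2) hkj.symm), mul_zero]
    · intro hj
      simp at hj
  have hex : ∃ d : Fin p → ℝ, ∃ L, IsModifiedCholesky Ω L d := ⟨d, L, h⟩
  have hD : choleskyD Ω = hex.choose := by
    rw [choleskyD, dif_pos hex]
  obtain ⟨M, hM⟩ := hex.choose_spec
  rw [hD]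
  generalize hex.choose = e at hM
  have main : ∀ j, e j = d j ∧ ∀ i, M i j = L i j := by
    intro j
    induction j using WellFoundedLT.induction with
    | ind j ih =>
      have hs : ∀ i, ∑ k ∈ Finset.univ.filter (· < j), M i k * e k * M j k =
          ∑ k ∈ Finset.univ.filter (· < j), L i k * d k * L j k := by
        intro i
        refine Finset.sum_congr rfl fun k hk => ?_
        obtain ⟨h1, h2⟩ := ih k (Finset.mem_filter.1 hk).2
        rw [h1, h2, h2]
      have hm : ∀ i, M i j * e j = L i j * d j := by
        intro i
        have h1 := key M e hM i j
        have h2 := key L d h i j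
        rw [hs i] at h1
        linarith
      have hj : e j = d j := by
        have := hm j
        rwa [hM.unit_diag, h.unit_diag, one_mul, one_mul] at this
      refine ⟨hj, fun i => ?_⟩
      have := hm i
      rw [hj] at this
      exact mul_right_cancel₀ (h.pos j).ne' this
  exact funext fun j => (main j).1

/-- The unnormalized generalized G-Wishart density
`(∏ i, D_ii(Ω) ^ (δ_i / 2)) * exp (- tr (Ω U) / 2)`. -/
def wishartDensity {p : ℕ} (U : Matrix (Fin p) (Fin p) ℝ) (δ : Fin p → ℝ)
    (Ω : Matrix (Fin p) (Fin p) ℝ) : ℝ :=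
  (∏ i, choleskyD Ω i ^ (δ i / 2)) * Real.exp (-(1 / 2) * (Ω * U).trace)

/-- The positions `(i, j)` with `j ≤ i` at which a symmetric matrix with the zero pattern of `H`
has a free entry. -/
def FreePos {p : ℕ} (H : SimpleGraph (Fin p)) : Type :=
  {q : Fin p × Fin p // q.2 ≤ q.1 ∧ (q.1 = q.2 ∨ H.Adj q.1 q.2)}

instance freePosFinite {p : ℕ} (H : SimpleGraph (Fin p)) : Finite (FreePos H) :=
  inferInstanceAs (Finite {q : Fin p × Fin p // q.2 ≤ q.1 ∧ (q.1 = q.2 ∨ H.Adj q.1 q.2)})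

instance freePosFintype {p : ℕ} (H : SimpleGraph (Fin p)) : Fintype (FreePos H) :=
  Fintype.ofFinite _

open Classical in
/-- The symmetric matrix with the zero pattern of `H` that has given free entries. -/
def ofFree {p : ℕ} (H : SimpleGraph (Fin p)) (x : FreePos H → ℝ) :
    Matrix (Fin p) (Fin p) ℝ :=
  Matrix.of fun i j =>
    if h : j ≤ i ∧ (i = j ∨ H.Adj i j) then x ⟨(i, j), h⟩
    else if h : i ≤ j ∧ (j = i ∨ H.Adj j i) then x ⟨(j, i), h⟩
    else 0

/-- Matrices carry the product σ-algebra of their entries. -/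
instance matrixMeasurableSpace {p : ℕ} : MeasurableSpace (Matrix (Fin p) (Fin p) ℝ) :=
  inferInstanceAs (MeasurableSpace (Fin p → Fin p → ℝ))

theorem measurable_ofFree {p : ℕ} (H : SimpleGraph (Fin p)) : Measurable (ofFree H) := by
  refine measurable_pi_lambda _ fun i => measurable_pi_lambda _ fun j => ?_
  simp only [ofFree, Matrix.of_apply]
  split_ifs
  · exact measurable_pi_apply _
  · exact measurable_pi_apply _
  · exact measurable_const

/-- Lebesgue measure `dΩ` in the free entries, as a measure on matrices. -/
def freeLebesgue {p : ℕ} (H : SimpleGraph (Fin p)) : Measure (Matrix (Fin p) (Fin p) ℝ) :=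
  Measure.map (ofFree H) volume

/-- The measure on `PDCone H` with density `wishartDensity U δ` with respect to `dΩ`. -/
def wishartMeasure {p : ℕ} (H : SimpleGraph (Fin p)) (U : Matrix (Fin p) (Fin p) ℝ)
    (δ : Fin p → ℝ) : Measure (Matrix (Fin p) (Fin p) ℝ) :=
  ((freeLebesgue H).restrict (PDCone H)).withDensity
    fun Ω => ENNReal.ofReal (wishartDensity U δ Ω)

/-- The generalized G-Wishart distribution with parameters `U` and `δ`: the normalization of
`wishartMeasure H U δ`. -/
def genGWishart {p : ℕ} (H : SimpleGraph (Fin p)) (U : Matrix (Fin p) (Fin p) ℝ)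
    (δ : Fin p → ℝ) : Measure (Matrix (Fin p) (Fin p) ℝ) :=
  (wishartMeasure H U δ Set.univ)⁻¹ • wishartMeasure H U δ

/-- The leading principal submatrix with the rows and columns `0, …, k` (the matrix written
`Ω_{k+1}` when rows and columns are numbered from 1). -/
def leadingSub {p : ℕ} (Ω : Matrix (Fin p) (Fin p) ℝ) (k : Fin p) :
    Matrix {i : Fin p // i ≤ k} {i : Fin p // i ≤ k} ℝ :=
  Ω.submatrix Subtype.val Subtype.val

/-- The inverse of that submatrix, padded by zeros to a `p × p` matrix. -/
def paddedInv {p : ℕ} (Ω : Matrix (Fin p) (Fin p) ℝ) (k : Fin p) :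
    Matrix (Fin p) (Fin p) ℝ :=
  Matrix.of fun i j =>
    if h : i ≤ k ∧ j ≤ k then (leadingSub Ω k)⁻¹ ⟨i, h.1⟩ ⟨j, h.2⟩ else 0

/-- The shape parameter after `δ k`, which is `0` after the last one. -/
def nextShape {p : ℕ} (δ : Fin p → ℝ) (k : Fin p) : ℝ :=
  if h : (k : ℕ) + 1 < p then δ ⟨(k : ℕ) + 1, h⟩ else 0

/-- The matrix `∑ k, (δ_k - δ_{k+1}) [Ω_k⁻¹]⁰`. -/
def sigmaStar {p : ℕ} (δ : Fin p → ℝ) (Ω : Matrix (Fin p) (Fin p) ℝ) :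
    Matrix (Fin p) (Fin p) ℝ :=
  ∑ k, (δ k - nextShape δ k) • paddedInv Ω k

open Classical in
/-- The projection `A ↦ A_{G_σ}`: keep the entries on the diagonal and on the edges, and
replace the other entries by `0`. -/
def graphPart {p : ℕ} (H : SimpleGraph (Fin p)) (A : Matrix (Fin p) (Fin p) ℝ) :
    Matrix (Fin p) (Fin p) ℝ :=
  Matrix.of fun i j => if i = j ∨ H.Adj i j then A i j else 0

/-- The entrywise expectation of a random matrix. -/
def matrixExpectation {S : Type*} [MeasurableSpace S] {p : ℕ} (P : Measure S)
    (M : S → Matrix (Fin p) (Fin p) ℝ) : Matrix (Fin p) (Fin p) ℝ :=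
  Matrix.of fun i j => ∫ s, M s i j ∂P

end

/-! ### Leading principal minors and the modified Cholesky decomposition -/

/-! The identity says that the score of the density has mean zero. Since `det Ω_k` is the product of
the first `k` entries `D_ii`, summation by parts turns `∏ D_ii ^ (δ_i / 2)` into `∏ det (Ω_k) ^
((δ_k - δ_{k+1}) / 2)`. By Jacobi's formula the derivative of `log det Ω_k` in a direction `E` is
`tr (E [Ω_k⁻¹]⁰)`, so the derivative of the density `f` along `E` is `f * tr (E (Σ* - U)) / 2`.

Extend `f` by zero to all values of the free entries (`coneDensity`). The extension has a line
derivative everywhere, given by the same formula: at a singular boundary point `δ_i > 4` yields `f ≤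
K * det ^ 2`, so the derivative there is zero and no boundary term arises
(`hasLineDerivAt_coneDensity`). An integrable function with integrable line derivative has a
derivative of integral zero; hence `E[Σ*] - U` is orthogonal to every symmetric matrix with the zero
pattern, in particular to its own projection, which must vanish.

Integrability rests on `D_ii ≤ tr Ω` and `tr (Ω U) ≥ c tr Ω`: the density is at most a power of the
trace times a decaying exponential. The pole of `Ω_k⁻¹ = adj / det` only lowers the exponents of
`D_ii`, `i ≤ k`, by one, and they stay nonnegative. -/

theorem mul_diagonal_mul_transpose_apply {m n : Type*} [Fintype n] [DecidableEq n]
    (A : Matrix m n ℝ) (d : n → ℝ) (i j : m) :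
    (A * Matrix.diagonal d * Aᵀ) i j = ∑ k, A i k * d k * A j k := by
  rw [Matrix.mul_apply]
  simp only [Matrix.mul_diagonal, Matrix.transpose_apply]

/-- As `L` is lower triangular, the factorization restricts to leading blocks: row `i ≤ k` of `L`
has no entries beyond column `k`. -/
theorem IsModifiedCholesky.det_leadingSub {p : ℕ} {Ω L : Matrix (Fin p) (Fin p) ℝ}
    {d : Fin p → ℝ} (h : IsModifiedCholesky Ω L d) (k : Fin p) :
    (leadingSub Ω k).det = ∏ i : {i : Fin p // i ≤ k}, d i := by
  have h1 : leadingSub Ω k = leadingSub L k * Matrix.diagonal (fun i : {i : Fin p // i ≤ k} => d i)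
      * (leadingSub L k)ᵀ := by
    ext i j
    have : Ω i j = ∑ m, L i m * d m * L j m := by
      conv_lhs => rw [h.eq]
      exact mul_diagonal_mul_transpose_apply L d i j
    rw [mul_diagonal_mul_transpose_apply]
    simp only [leadingSub, Matrix.submatrix_apply]
    rw [this]
    have h2 := Finset.sum_subtype_of_mem (s := Finset.univ.filter (· ≤ k)) (p := fun m => m ≤ k)
      (fun m => L i m * d m * L j m) (by simp)
    rw [← Finset.sum_subset (Finset.filter_subset (· ≤ k) Finset.univ), ← h2]
    · refine Finset.sum_congr ?_ fun _ _ => rfl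
      ext x
      simp [x.2]
    · intro m _ hm
      rw [h.lower i m (lt_of_le_of_lt i.2 (by simpa using hm)), zero_mul, zero_mul]
  have hL : (leadingSub L k).det = 1 := by
    rw [Matrix.det_of_isLowerTriangular]
    · exact Finset.prod_eq_one fun i _ => h.unit_diag _
    · intro i j hij
      exact h.lower i j hij
  rw [h1, Matrix.det_mul, Matrix.det_mul, Matrix.det_transpose, hL, Matrix.det_diagonal]
  ring

theorem Matrix.PosDef.isModifiedCholesky {p : ℕ} {Ω : Matrix (Fin p) (Fin p) ℝ} (hΩ : Ω.PosDef) :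
    ∃ L, IsModifiedCholesky Ω L (choleskyD Ω) := by
  obtain ⟨d, L, h⟩ := exists_isModifiedCholesky hΩ
  exact ⟨L, h.choleskyD_eq ▸ h⟩

theorem choleskyD_pos {p : ℕ} {Ω : Matrix (Fin p) (Fin p) ℝ} (hΩ : Ω.PosDef) (i : Fin p) :
    0 < choleskyD Ω i := by
  obtain ⟨L, h⟩ := hΩ.isModifiedCholesky
  exact h.pos i

/-- In `Ω i i = ∑ m, D_m * L i m ^ 2` all terms are nonnegative and the term `m = i` is `D_i`. -/
theorem choleskyD_le {p : ℕ} {Ω : Matrix (Fin p) (Fin p) ℝ} (hΩ : Ω.PosDef) (i : Fin p) :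
    choleskyD Ω i ≤ Ω i i := by
  obtain ⟨L, h⟩ := hΩ.isModifiedCholesky
  have : Ω i i = ∑ m, L i m * choleskyD Ω m * L i m := by
    conv_lhs => rw [h.eq]
    exact mul_diagonal_mul_transpose_apply L _ i i
  rw [this]
  have h2 := Finset.single_le_sum (f := fun m => L i m * choleskyD Ω m * L i m)
    (fun m _ => by
      have := (h.pos m).le
      show 0 ≤ L i m * choleskyD Ω m * L i m
      have e : L i m * choleskyD Ω m * L i m = choleskyD Ω m * (L i m * L i m) := by ring
      rw [e]
      exact mul_nonneg this (mul_self_nonneg _)) (Finset.mem_univ i)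
  simpa [h.unit_diag] using h2

theorem Matrix.PosDef.det_leadingSub {p : ℕ} {Ω : Matrix (Fin p) (Fin p) ℝ} (hΩ : Ω.PosDef)
    (k : Fin p) : (leadingSub Ω k).det = ∏ i, if i ≤ k then choleskyD Ω i else 1 := by
  obtain ⟨L, h⟩ := hΩ.isModifiedCholesky
  rw [h.det_leadingSub, ← Finset.prod_filter]
  exact (Finset.prod_subtype _ (by simp) _).symm

theorem Matrix.PosDef.det_eq_prod_choleskyD {p : ℕ} {Ω : Matrix (Fin p) (Fin p) ℝ}
    (hΩ : Ω.PosDef) : Ω.det = ∏ i, choleskyD Ω i := by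
  obtain ⟨L, h⟩ := hΩ.isModifiedCholesky
  have hL : L.det = 1 := by
    rw [Matrix.det_of_isLowerTriangular]
    · exact Finset.prod_eq_one fun i _ => h.unit_diag _
    · intro i j hij
      exact h.lower i j hij
  conv_lhs => rw [h.eq]
  rw [Matrix.det_mul, Matrix.det_mul, Matrix.det_transpose, hL, Matrix.det_diagonal]
  ring

theorem Matrix.PosDef.leadingSub {p : ℕ} {Ω : Matrix (Fin p) (Fin p) ℝ} (hΩ : Ω.PosDef)
    (k : Fin p) : (leadingSub Ω k).PosDef :=
  hΩ.submatrix Subtype.val_injective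

/-- Telescoping; the convention `δ_{p+1} = 0` removes the upper end term. -/
theorem sum_ite_shape_sub_nextShape {p : ℕ} (δ : Fin p → ℝ) (i : Fin p) :
    ∑ k, (if i ≤ k then δ k - nextShape δ k else 0) = δ i := by
  -- Extension of `δ` by zero to all naturals, so that `a (k + 1)` is `nextShape δ k` even at the
  -- last index.
  set a : ℕ → ℝ := fun n => if h : n < p then δ ⟨n, h⟩ else 0 with ha
  have h1 : ∀ m : ℕ, ∑ n ∈ Finset.range m, (if (i : ℕ) ≤ n then a n - a (n + 1) else 0) =
      if (i : ℕ) ≤ m then a i - a m else 0 := by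
    intro m
    induction m with
    | zero =>
      by_cases h : (i : ℕ) ≤ 0
      · simp [Nat.le_zero.1 h]
      · simp [h]
    | succ m ih =>
      rw [Finset.sum_range_succ, ih]
      by_cases h : (i : ℕ) ≤ m
      · simp [h, Nat.le_succ_of_le h]
      · by_cases h' : (i : ℕ) = m + 1
        · simp [h']
        · have : ¬ (i : ℕ) ≤ m + 1 := by omega
          simp [h, this]
  have h2 := h1 p
  rw [← Fin.sum_univ_eq_sum_range (fun n => if (i : ℕ) ≤ n then a n - a (n + 1) else 0) p,
    if_pos i.2.le] at h2
  have h3 : a i = δ i := by simp [ha]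
  have h4 : a p = 0 := by simp [ha]
  rw [h3, h4, sub_zero] at h2
  rw [← h2]
  refine Finset.sum_congr rfl fun k _ => ?_
  have h5 : a k = δ k := by simp [ha]
  have h6 : a (k + 1) = nextShape δ k := rfl
  rw [h5, h6]
  rfl

/-- On positive definite matrices the density is the exponential of a combination of the logarithms
of the leading principal minors and a linear function. -/
theorem Matrix.PosDef.wishartDensity_eq {p : ℕ} (U : Matrix (Fin p) (Fin p) ℝ) (δ : Fin p → ℝ)
    {Ω : Matrix (Fin p) (Fin p) ℝ} (hΩ : Ω.PosDef) :
    wishartDensity U δ Ω = Real.exp (∑ k, Real.log (_root_.leadingSub Ω k).det *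
      ((δ k - nextShape δ k) / 2) + -(1 / 2) * (Ω * U).trace) := by
  rw [wishartDensity, Real.exp_add, Real.exp_sum]
  simp_rw [← Real.rpow_def_of_pos (hΩ.leadingSub _).det_pos]
  congr 1
  have h1 : ∀ k, (_root_.leadingSub Ω k).det ^ ((δ k - nextShape δ k) / 2) =
      ∏ i, choleskyD Ω i ^ ((if i ≤ k then δ k - nextShape δ k else 0) / 2) := by
    intro k
    rw [hΩ.det_leadingSub, ← Real.finsetProd_rpow]
    · refine Finset.prod_congr rfl fun i _ => ?_
      split_ifs <;> simp
    · intro i _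
      split_ifs
      · exact (choleskyD_pos hΩ i).le
      · exact zero_le_one
  simp_rw [h1]
  rw [Finset.prod_comm]
  refine Finset.prod_congr rfl fun i _ => ?_
  rw [← Real.rpow_sum_of_pos (choleskyD_pos hΩ i), ← Finset.sum_div,
    sum_ite_shape_sub_nextShape]

theorem wishartDensity_pos {p : ℕ} (U : Matrix (Fin p) (Fin p) ℝ) (δ : Fin p → ℝ)
    {Ω : Matrix (Fin p) (Fin p) ℝ} (hΩ : Ω.PosDef) : 0 < wishartDensity U δ Ω :=
  mul_pos (Finset.prod_pos fun i _ => Real.rpow_pos_of_pos (choleskyD_pos hΩ i) _)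
    (Real.exp_pos _)

/-! ### Bounds for positive definite matrices -/

theorem Matrix.PosDef.diag_le_trace {p : ℕ} {Ω : Matrix (Fin p) (Fin p) ℝ} (hΩ : Ω.PosDef)
    (i : Fin p) : Ω i i ≤ Ω.trace :=
  Finset.single_le_sum (f := fun i => Ω i i) (fun _ _ => hΩ.diag_pos.le) (Finset.mem_univ i)

/-- Testing the form on `e_i ± e_j` bounds `2 |Ω i j|` by `Ω i i + Ω j j`. The trace thus dominates
the sup norm of the free entries. -/
theorem Matrix.PosDef.abs_apply_le_trace {p : ℕ} {Ω : Matrix (Fin p) (Fin p) ℝ} (hΩ : Ω.PosDef)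
    (i j : Fin p) : |Ω i j| ≤ Ω.trace := by
  have hs : Ω j i = Ω i j := by simpa using hΩ.isHermitian.apply i j
  have key : ∀ s : ℝ, s * s = 1 → 0 ≤ Ω i i + Ω j j + 2 * s * Ω i j := by
    intro s hs1
    have h := hΩ.posSemidef.dotProduct_mulVec_nonneg (Pi.single i 1 + s • Pi.single j 1)
    simp [Matrix.mulVec_add, Matrix.mulVec_smul, add_dotProduct, hs] at h
    linear_combination h + (Ω j j) * hs1
  have h1 := key 1 (by norm_num)
  have h2 := key (-1) (by norm_num)
  have h3 := hΩ.diag_le_trace i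
  have h4 := hΩ.diag_le_trace j
  rw [abs_le]
  constructor <;> linarith

/-- In an eigenbasis of `U`, `tr (Ω U)` is the sum of the nonnegative diagonal entries of `Ω`
weighted by the eigenvalues; `c` is the least eigenvalue. -/
theorem exists_pos_mul_trace_le_trace_mul {n : Type*} [Fintype n] [DecidableEq n]
    {U : Matrix n n ℝ} (hU : U.PosDef) :
    ∃ c > 0, ∀ Ω : Matrix n n ℝ, Ω.PosSemidef → c * Ω.trace ≤ (Ω * U).trace := by
  obtain ⟨c, hc, hcl⟩ : ∃ c > 0, ∀ i, c ≤ hU.isHermitian.eigenvalues i := by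
    rcases isEmpty_or_nonempty n with h | h
    · exact ⟨1, one_pos, fun i => h.elim i⟩
    · obtain ⟨i, hi⟩ := Finite.exists_min hU.isHermitian.eigenvalues
      exact ⟨_, hU.eigenvalues_pos i, hi⟩
  refine ⟨c, hc, fun Ω hΩ => ?_⟩
  set V : Matrix n n ℝ := (hU.isHermitian.eigenvectorUnitary : Matrix n n ℝ) with hV
  have hVV : V * star V = 1 := Unitary.coe_mul_star_self hU.isHermitian.eigenvectorUnitary
  have hsp : U = V * diagonal hU.isHermitian.eigenvalues * star V := by
    conv_lhs => rw [hU.isHermitian.spectral_theorem, Unitary.conjStarAlgAut_apply]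
    rfl
  have hN : (star V * Ω * V).PosSemidef := hΩ.conjTranspose_mul_mul_same V
  have h1 : (Ω * U).trace = ∑ i, (star V * Ω * V) i i * hU.isHermitian.eigenvalues i := by
    conv_lhs => rw [hsp]
    rw [← Matrix.mul_assoc, Matrix.trace_mul_comm, ← Matrix.mul_assoc, ← Matrix.mul_assoc]
    simp [Matrix.trace, Matrix.mul_diagonal]
  have h2 : Ω.trace = ∑ i, (star V * Ω * V) i i := by
    change _ = (star V * Ω * V).trace
    rw [Matrix.trace_mul_comm, ← Matrix.mul_assoc, hVV, Matrix.one_mul]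
  rw [h1, h2, Finset.mul_sum]
  refine Finset.sum_le_sum fun i _ => ?_
  rw [mul_comm]
  exact mul_le_mul_of_nonneg_left (hcl i) hN.diag_nonneg

/-- An adjugate entry is the determinant of `A` with one row replaced by a basis vector; `1 ≤ x`
covers that row. -/
theorem abs_adjugate_le {n : Type*} [Fintype n] [DecidableEq n] {A : Matrix n n ℝ} {x : ℝ}
    (hx : 1 ≤ x) (hA : ∀ i j, |A i j| ≤ x) (i j : n) :
    |A.adjugate i j| ≤ (Fintype.card n).factorial * x ^ Fintype.card n := by
  rw [Matrix.adjugate_apply, ← nsmul_eq_mul]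
  refine Matrix.det_le (abv := AbsoluteValue.abs) fun k l => ?_
  rw [Matrix.updateRow_apply]
  split_ifs
  · rw [Pi.single_apply]
    split_ifs <;> simp <;> linarith
  · exact hA k l

/-! ### Directional derivative of the determinant -/

/-- Write `A + t E = A (1 + t A⁻¹ E)`; the polynomial `det (1 + X M)` has derivative `tr M` at zero.
-/
theorem hasDerivAt_det_add_smul {n : Type*} [Fintype n] [DecidableEq n] (A E : Matrix n n ℝ)
    (hA : IsUnit A.det) :
    HasDerivAt (fun t : ℝ => (A + t • E).det) (A.det * (A⁻¹ * E).trace) 0 := by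
  have h1 : ∀ t : ℝ, (A + t • E).det = A.det *
      (det (1 + (Polynomial.X : Polynomial ℝ) • (A⁻¹ * E).map Polynomial.C)).eval t := by
    intro t
    have : A + t • E = A * (1 + t • (A⁻¹ * E)) := by
      rw [Matrix.mul_add, Matrix.mul_one, Matrix.mul_smul, ← Matrix.mul_assoc,
        Matrix.mul_nonsing_inv _ hA, Matrix.one_mul]
    rw [this, Matrix.det_mul, ← Polynomial.coe_evalRingHom, RingHom.map_det]
    generalize A⁻¹ * E = M
    congr 2
    ext i j
    simp [Matrix.one_apply, apply_ite]
    exact mul_comm _ _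
  simp_rw [h1]
  rw [← Matrix.derivative_det_one_add_X_smul]
  exact (Polynomial.hasDerivAt _ 0).const_mul _

/-! ### Topology and measurability of the cone -/

/-- The quadratic form of `A` is at least `c |x|²`, and a small entrywise perturbation cannot undo
this. Symmetry is not an open condition, hence the restriction to Hermitian `M`. -/
theorem Matrix.PosDef.eventually_posDef {n : Type*} [Fintype n] {A : Matrix n n ℝ}
    (hA : A.PosDef) : ∀ᶠ M in nhds A, M.IsHermitian → M.PosDef := by
  classical
  obtain ⟨c, hc, h⟩ := exists_pos_mul_trace_le_trace_mul hA
  have h1 : ∀ x : n → ℝ, c * (x ⬝ᵥ x) ≤ x ⬝ᵥ A *ᵥ x := by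
    intro x
    -- The trace inequality at the rank one matrix `x xᵀ` is a bound on the quadratic form.
    have := h (vecMulVec x (star x)) (posSemidef_vecMulVec_self_star x)
    rw [Matrix.trace_mul_comm, Matrix.mul_vecMulVec, Matrix.trace_vecMulVec,
      Matrix.trace_vecMulVec] at this
    simpa [dotProduct_comm] using this
  -- The form changes by at most `ε n |x|²`; dividing by `n + 1` makes this strictly less than `c
  -- |x|²`, also for `n = 0`.
  set ε : ℝ := c / (Fintype.card n + 1) with hε
  have hcard : (0 : ℝ) < Fintype.card n + 1 := by positivity
  have hε0 : 0 < ε := by positivity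
  have h2 : ∀ᶠ M in nhds A, ∀ i j, |M i j - A i j| < ε := by
    rw [Filter.eventually_all]
    intro i
    rw [Filter.eventually_all]
    intro j
    have hcont : Continuous fun M : Matrix n n ℝ => |M i j - A i j| :=
      ((continuous_id.matrix_elem i j).sub continuous_const).abs
    have := hcont.tendsto A
    simp only [sub_self, abs_zero] at this
    exact this.eventually_lt_const hε0
  filter_upwards [h2] with M hM hherm
  refine Matrix.PosDef.of_dotProduct_mulVec_pos hherm fun x hx => ?_
  rw [star_trivial]
  have hxx : 0 < x ⬝ᵥ x := by
    have := Matrix.dotProduct_star_self_pos_iff.2 hx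
    simpa using this
  have h3 : M = A + (M - A) := by abel
  have h4 : x ⬝ᵥ M *ᵥ x = x ⬝ᵥ A *ᵥ x + x ⬝ᵥ (M - A) *ᵥ x := by
    conv_lhs => rw [h3, Matrix.add_mulVec, dotProduct_add]
  have h5 : |x ⬝ᵥ (M - A) *ᵥ x| ≤ ε * (Fintype.card n * (x ⬝ᵥ x)) := by
    have e1 : x ⬝ᵥ (M - A) *ᵥ x = ∑ i, ∑ j, x i * ((M i j - A i j) * x j) := by
      simp [dotProduct, Matrix.mulVec, Finset.mul_sum]
    have e2 : (Fintype.card n : ℝ) * (x ⬝ᵥ x) = ∑ i, ∑ j, (x i * x i + x j * x j) / 2 := by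
      simp only [dotProduct, add_div, Finset.sum_add_distrib, Finset.sum_const, Finset.card_univ,
        nsmul_eq_mul, ← Finset.mul_sum, ← Finset.sum_div]
      ring
    rw [e1, e2, Finset.mul_sum]
    refine (Finset.abs_sum_le_sum_abs _ _).trans (Finset.sum_le_sum fun i _ => ?_)
    rw [Finset.mul_sum]
    refine (Finset.abs_sum_le_sum_abs _ _).trans (Finset.sum_le_sum fun j _ => ?_)
    rw [abs_mul, abs_mul]
    have e3 : |x i| * |x j| ≤ (x i * x i + x j * x j) / 2 := by
      nlinarith [sq_nonneg (|x i| - |x j|), abs_mul_abs_self (x i), abs_mul_abs_self (x j)]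
    calc |x i| * (|M i j - A i j| * |x j|) = |M i j - A i j| * (|x i| * |x j|) := by ring
      _ ≤ ε * ((x i * x i + x j * x j) / 2) :=
        mul_le_mul (hM i j).le e3 (by positivity) hε0.le
  have h6 : ε * (Fintype.card n * (x ⬝ᵥ x)) < c * (x ⬝ᵥ x) := by
    rw [← mul_assoc]
    refine mul_lt_mul_of_pos_right ?_ hxx
    rw [hε, div_mul_eq_mul_div, div_lt_iff₀ hcard]
    linarith [mul_comm c ((Fintype.card n : ℝ) + 1)]
  have h7 := abs_le.1 h5
  have := h1 x
  linarith

theorem isClosed_setOf_posSemidef {n : Type*} [Fintype n] :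
    IsClosed {A : Matrix n n ℝ | A.PosSemidef} := by
  simp only [posSemidef_iff_dotProduct_mulVec, Set.ofPred_and, Set.ofPred_forall]
  refine IsClosed.inter ?_ (isClosed_iInter fun x => ?_)
  · exact isClosed_eq continuous_id.matrix_conjTranspose continuous_id
  · exact isClosed_le continuous_const
      (continuous_const.dotProduct (continuous_id.matrix_mulVec continuous_const))

instance matrixBorelSpace {p : ℕ} : BorelSpace (Matrix (Fin p) (Fin p) ℝ) :=
  inferInstanceAs (BorelSpace (Fin p → Fin p → ℝ))

theorem setOf_posDef_eq {n : Type*} [Fintype n] [DecidableEq n] :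
    {A : Matrix n n ℝ | A.PosDef} = {A | A.PosSemidef} ∩ {A | A.det ≠ 0} := by
  ext A
  constructor
  · exact fun h => ⟨h.posSemidef, h.det_pos.ne'⟩
  · exact fun h => h.1.posDef_iff_det_ne_zero.2 h.2

theorem measurableSet_setOf_posDef {p : ℕ} :
    MeasurableSet {A : Matrix (Fin p) (Fin p) ℝ | A.PosDef} := by
  rw [setOf_posDef_eq]
  refine isClosed_setOf_posSemidef.measurableSet.inter (IsOpen.measurableSet ?_)
  exact isOpen_ne_fun continuous_id.matrix_det continuous_const

theorem measurableSet_PDCone {p : ℕ} (H : SimpleGraph (Fin p)) : MeasurableSet (PDCone H) := by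
  have h : PDCone H = {A | A.PosDef} ∩
      ⋂ (i) (j) (_ : i ≠ j) (_ : ¬ H.Adj i j), {A | A i j = 0} := by
    ext A
    simp [PDCone]
  rw [h]
  refine measurableSet_setOf_posDef.inter ?_
  refine MeasurableSet.iInter fun i => MeasurableSet.iInter fun j => MeasurableSet.iInter fun _ =>
    MeasurableSet.iInter fun _ => IsClosed.measurableSet ?_
  exact isClosed_eq (continuous_id.matrix_elem i j) continuous_const

theorem continuous_det_leadingSub {p : ℕ} (k : Fin p) :
    Continuous fun Ω : Matrix (Fin p) (Fin p) ℝ => (leadingSub Ω k).det :=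
  (continuous_id.matrix_submatrix Subtype.val Subtype.val).matrix_det

theorem measurable_paddedInv_apply {p : ℕ} (k i j : Fin p) :
    Measurable fun Ω : Matrix (Fin p) (Fin p) ℝ => paddedInv Ω k i j := by
  simp only [paddedInv, Matrix.of_apply]
  split_ifs with h
  · simp only [Matrix.inv_def, Ring.inverse_eq_inv', Matrix.smul_apply, smul_eq_mul]
    refine (continuous_det_leadingSub k).measurable.inv.mul (Continuous.measurable ?_)
    exact ((continuous_id.matrix_submatrix Subtype.val Subtype.val).matrix_adjugate).matrix_elem _ _
  · exact measurable_const

theorem measurable_sigmaStar_apply {p : ℕ} (δ : Fin p → ℝ) (i j : Fin p) :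
    Measurable fun Ω : Matrix (Fin p) (Fin p) ℝ => sigmaStar δ Ω i j := by
  simp only [sigmaStar, Matrix.sum_apply, Matrix.smul_apply, smul_eq_mul]
  exact Finset.measurable_sum _ fun k _ => (measurable_paddedInv_apply k i j).const_mul _

/-! ### Free entries -/

section FreeEntries

variable {p : ℕ} (H : SimpleGraph (Fin p))

theorem ofFree_add_smul (x v : FreePos H → ℝ) (t : ℝ) :
    ofFree H (x + t • v) = ofFree H x + t • ofFree H v := by
  ext i j
  simp only [ofFree, Matrix.of_apply, Matrix.add_apply, Matrix.smul_apply, smul_eq_mul]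
  split_ifs
  · rfl
  · rfl
  · ring

theorem continuous_ofFree : Continuous (ofFree H) := by
  refine continuous_matrix fun i j => ?_
  simp only [ofFree, Matrix.of_apply]
  split_ifs
  · exact continuous_apply _
  · exact continuous_apply _
  · exact continuous_const

theorem ofFree_apply_comm (x : FreePos H → ℝ) (i j : Fin p) :
    ofFree H x i j = ofFree H x j i := by
  simp only [ofFree, Matrix.of_apply]
  by_cases h1 : j ≤ i ∧ (i = j ∨ H.Adj i j)
  · by_cases h2 : i ≤ j ∧ (j = i ∨ H.Adj j i)
    · obtain rfl : i = j := le_antisymm h2.1 h1.1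
      rfl
    · rw [dif_pos h1, dif_neg h2, dif_pos h1]
  · by_cases h2 : i ≤ j ∧ (j = i ∨ H.Adj j i)
    · rw [dif_neg h1, dif_pos h2, dif_pos h2]
    · rw [dif_neg h1, dif_neg h2, dif_neg h2, dif_neg h1]

theorem isHermitian_ofFree (x : FreePos H → ℝ) : (ofFree H x).IsHermitian := by
  ext i j
  simpa using ofFree_apply_comm H x j i

theorem ofFree_apply_val (x : FreePos H → ℝ) (q : FreePos H) :
    ofFree H x q.1.1 q.1.2 = x q := by
  simp only [ofFree, Matrix.of_apply]
  rw [dif_pos q.2]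
  rfl

theorem ofFree_apply_eq_zero (x : FreePos H → ℝ) {i j : Fin p} (hij : i ≠ j)
    (h : ¬ H.Adj i j) : ofFree H x i j = 0 := by
  simp only [ofFree, Matrix.of_apply]
  rw [dif_neg, dif_neg]
  · rintro ⟨-, h1 | h1⟩
    · exact hij h1.symm
    · exact h h1.symm
  · rintro ⟨-, h1 | h1⟩
    · exact hij h1
    · exact h h1

theorem ofFree_mem_PDCone_iff (x : FreePos H → ℝ) :
    ofFree H x ∈ PDCone H ↔ (ofFree H x).PosDef :=
  ⟨fun h => h.1, fun h => ⟨h, fun _ _ hij hn => ofFree_apply_eq_zero H x hij hn⟩⟩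

/-- The projection of a symmetric matrix is determined by its free entries. -/
theorem ofFree_eq_graphPart {A : Matrix (Fin p) (Fin p) ℝ} (hA : ∀ i j, A i j = A j i) :
    ofFree H (fun q => A q.1.1 q.1.2) = graphPart H A := by
  ext i j
  by_cases h : i = j ∨ H.Adj i j
  · simp only [graphPart, Matrix.of_apply, if_pos h]
    rcases le_total j i with hle | hle
    · exact ofFree_apply_val H _ ⟨(i, j), hle, h⟩
    · rw [ofFree_apply_comm, hA]
      exact ofFree_apply_val H _ ⟨(j, i), hle, h.imp Eq.symm SimpleGraph.Adj.symm⟩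
  · simp only [graphPart, Matrix.of_apply, if_neg h]
    push Not at h
    exact ofFree_apply_eq_zero H _ h.1 h.2

/-- A symmetric matrix that is orthogonal to all symmetric matrices with the zero pattern of a
graph vanishes on the diagonal and on the edges. -/
theorem graphPart_eq_zero_of_trace_ofFree_mul_eq_zero {A : Matrix (Fin p) (Fin p) ℝ}
    (hA : ∀ i j, A i j = A j i) (h : ∀ v, (ofFree H v * A).trace = 0) : graphPart H A = 0 := by
  -- Test against the projection of `A` itself: the trace becomes a sum of squares.
  have h1 := h fun q => A q.1.1 q.1.2
  rw [ofFree_eq_graphPart H hA] at h1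
  have h2 : (graphPart H A * A).trace = ∑ i, ∑ j, graphPart H A i j ^ 2 := by
    simp only [Matrix.trace, Matrix.diag_apply, Matrix.mul_apply]
    refine Finset.sum_congr rfl fun i _ => Finset.sum_congr rfl fun j _ => ?_
    simp only [graphPart, Matrix.of_apply]
    split_ifs
    · rw [hA j i, sq]
    · simp
  rw [h2] at h1
  ext i j
  have h3 := (Finset.sum_eq_zero_iff_of_nonneg fun i _ =>
    Finset.sum_nonneg fun j _ => sq_nonneg (graphPart H A i j)).1 h1 i (Finset.mem_univ i)
  have h4 := (Finset.sum_eq_zero_iff_of_nonneg fun j _ =>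
    sq_nonneg (graphPart H A i j)).1 h3 j (Finset.mem_univ j)
  exact pow_eq_zero_iff two_ne_zero |>.1 h4

theorem isOpen_setOf_posDef_ofFree : IsOpen {x | (ofFree H x).PosDef} := by
  rw [isOpen_iff_mem_nhds]
  intro x hx
  filter_upwards [(continuous_ofFree H).continuousAt.eventually
    (Matrix.PosDef.eventually_posDef hx)] with y hy
  exact hy (isHermitian_ofFree H y)

theorem exists_ofFree_eq_one : ∃ x, ofFree H x = 1 := by
  refine ⟨fun q => (1 : Matrix (Fin p) (Fin p) ℝ) q.1.1 q.1.2, ?_⟩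
  rw [ofFree_eq_graphPart]
  · ext i j
    simp only [graphPart, Matrix.of_apply, Matrix.one_apply]
    split_ifs <;> simp_all
  · intro i j
    simp [Matrix.one_apply, eq_comm]

end FreeEntries

/-! ### The density in free entries and its integrability -/

/-- The unnormalized density as a function of the free entries, extended by zero. -/
noncomputable def coneDensity {p : ℕ} (H : SimpleGraph (Fin p)) (U : Matrix (Fin p) (Fin p) ℝ)
    (δ : Fin p → ℝ) : (FreePos H → ℝ) → ℝ :=
  Set.indicator {x | (ofFree H x).PosDef} fun x => wishartDensity U δ (ofFree H x)

section ConeDensity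

variable {p : ℕ} (H : SimpleGraph (Fin p)) (U : Matrix (Fin p) (Fin p) ℝ) (δ : Fin p → ℝ)

theorem coneDensity_of_posDef {x : FreePos H → ℝ} (hx : (ofFree H x).PosDef) :
    coneDensity H U δ x = wishartDensity U δ (ofFree H x) :=
  Set.indicator_of_mem (s := {x | (ofFree H x).PosDef}) hx _

theorem coneDensity_of_not_posDef {x : FreePos H → ℝ} (hx : ¬ (ofFree H x).PosDef) :
    coneDensity H U δ x = 0 :=
  Set.indicator_of_notMem (s := {x | (ofFree H x).PosDef}) hx _

theorem coneDensity_nonneg (x : FreePos H → ℝ) : 0 ≤ coneDensity H U δ x :=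
  Set.indicator_nonneg (fun _ hx => (wishartDensity_pos U δ hx).le) x

/-- `choleskyD` is defined by choice, so measurability goes through the formula in the leading
minors. -/
theorem measurable_coneDensity : Measurable (coneDensity H U δ) := by
  have h : coneDensity H U δ = Set.indicator {x | (ofFree H x).PosDef} fun x =>
      Real.exp (∑ k, Real.log (leadingSub (ofFree H x) k).det *
        ((δ k - nextShape δ k) / 2) + -(1 / 2) * (ofFree H x * U).trace) :=
    Set.indicator_congr fun x hx => Matrix.PosDef.wishartDensity_eq U δ hx
  rw [h]
  refine Measurable.indicator ?_ (isOpen_setOf_posDef_ofFree H).measurableSet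
  refine Real.measurable_exp.comp (Measurable.add ?_ ?_)
  · refine Finset.measurable_sum _ fun k _ => Measurable.mul_const ?_ _
    exact Real.measurable_log.comp
      ((continuous_det_leadingSub k).comp (continuous_ofFree H)).measurable
  · exact (Continuous.matrix_trace
      ((continuous_ofFree H).matrix_mul continuous_const)).measurable.const_mul _

theorem exists_one_add_rpow_le_mul_exp {c : ℝ} (hc : 0 < c) {N : ℝ} (hN : 0 ≤ N) :
    ∃ M, ∀ T : ℝ, 0 ≤ T → (1 + T) ^ N ≤ M * Real.exp (c * T) := by
  -- Chosen so that `b * N ≤ c`: the `N`-th power of `1 + T ≤ (1 + 1 / b) * exp (b * T)` is then the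
  -- claim.
  set b : ℝ := c / (N + 1) with hb
  have hb0 : 0 < b := by positivity
  refine ⟨(1 + 1 / b) ^ N, fun T hT => ?_⟩
  have h1 : 1 + T ≤ (1 + 1 / b) * Real.exp (b * T) := by
    have h2 := Real.add_one_le_exp (b * T)
    have h3 : 1 + T ≤ (1 + 1 / b) * (b * T + 1) := by
      have : (1 + 1 / b) * (b * T + 1) = 1 + T + (1 / b + b * T) := by
        field_simp
        ring
      rw [this]
      have : 0 ≤ 1 / b + b * T := by positivity
      linarith
    exact h3.trans (mul_le_mul_of_nonneg_left h2 (by positivity))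
  calc (1 + T) ^ N ≤ ((1 + 1 / b) * Real.exp (b * T)) ^ N :=
        Real.rpow_le_rpow (by positivity) h1 hN
    _ = (1 + 1 / b) ^ N * Real.exp (b * T * N) := by
        rw [Real.mul_rpow (by positivity) (Real.exp_pos _).le, Real.exp_mul (b * T)]
    _ ≤ (1 + 1 / b) ^ N * Real.exp (c * T) := by
        refine mul_le_mul_of_nonneg_left (Real.exp_le_exp.2 ?_) (by positivity)
        rw [mul_right_comm]
        refine mul_le_mul_of_nonneg_right ?_ hT
        rw [hb, div_mul_eq_mul_div, div_le_iff₀ (by positivity)]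
        nlinarith

/-- A function supported on the cone that is dominated by a power of the trace times a decaying
exponential of the trace is integrable in the free entries. -/
theorem integrable_of_abs_le_trace {g : (FreePos H → ℝ) → ℝ} (hg : Measurable g)
    (h0 : ∀ x, ¬ (ofFree H x).PosDef → g x = 0) {c K N : ℝ} (hc : 0 < c) (hN : 0 ≤ N)
    (h : ∀ x, (ofFree H x).PosDef →
      |g x| ≤ K * (1 + (ofFree H x).trace) ^ N * Real.exp (-(c * (ofFree H x).trace))) :
    Integrable g := by
  -- The exponential is traded for `(1 + ‖x‖) ^ (-r)`, integrable because `r` exceeds the dimension.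
  set r : ℝ := Module.finrank ℝ (FreePos H → ℝ) + 1 with hr
  have hr0 : 0 ≤ r := by positivity
  obtain ⟨M, hM⟩ := exists_one_add_rpow_le_mul_exp hc (add_nonneg hN hr0)
  have hint : Integrable (fun x : FreePos H → ℝ => (1 + ‖x‖) ^ (-r)) :=
    integrable_one_add_norm (by rw [hr]; linarith)
  refine (hint.const_mul (|K| * M)).mono' hg.aestronglyMeasurable (.of_forall fun x => ?_)
  have hM0 : 0 ≤ M := by
    have := hM 0 le_rfl
    simp at this
    linarith
  by_cases hx : (ofFree H x).PosDef
  · set T := (ofFree H x).trace with hT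
    have hT0 : 0 ≤ T := hx.posSemidef.trace_nonneg
    have hxT : ‖x‖ ≤ T := by
      rw [pi_norm_le_iff_of_nonneg hT0]
      intro q
      rw [← ofFree_apply_val H x q]
      exact hx.abs_apply_le_trace _ _
    have h1 : (1 + T) ^ N * Real.exp (-(c * T)) ≤ M * (1 + T) ^ (-r) := by
      have h2 := hM T hT0
      rw [Real.rpow_add (by positivity)] at h2
      have h3 : 0 < (1 + T) ^ r := by positivity
      rw [Real.rpow_neg (by positivity), Real.exp_neg, ← div_eq_mul_inv, ← div_eq_mul_inv,
        div_le_div_iff₀ (Real.exp_pos _) h3]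
      exact h2
    have h4 : (1 + T) ^ (-r) ≤ (1 + ‖x‖) ^ (-r) :=
      Real.rpow_le_rpow_of_nonpos (by positivity) (by linarith) (by linarith)
    calc ‖g x‖ ≤ K * (1 + T) ^ N * Real.exp (-(c * T)) := h x hx
      _ ≤ |K| * ((1 + T) ^ N * Real.exp (-(c * T))) := by
        rw [mul_assoc]
        exact mul_le_mul_of_nonneg_right (le_abs_self K) (by positivity)
      _ ≤ |K| * (M * (1 + ‖x‖) ^ (-r)) := 
        mul_le_mul_of_nonneg_left (h1.trans (mul_le_mul_of_nonneg_left h4 hM0)) (abs_nonneg K)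
      _ = _ := by ring
  · rw [h0 x hx, norm_zero]
    positivity

variable {δ U}

theorem prod_choleskyD_rpow_le {Ω : Matrix (Fin p) (Fin p) ℝ} (hΩ : Ω.PosDef) {e : Fin p → ℝ}
    (he : ∀ i, 0 ≤ e i) : ∏ i, choleskyD Ω i ^ e i ≤ (1 + Ω.trace) ^ ∑ i, e i := by
  have hT := hΩ.posSemidef.trace_nonneg
  rw [Real.rpow_sum_of_pos (by positivity)]
  refine Finset.prod_le_prod (fun i _ => Real.rpow_nonneg (choleskyD_pos hΩ i).le _) fun i _ => ?_
  refine Real.rpow_le_rpow (choleskyD_pos hΩ i).le ?_ (he i)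
  linarith [choleskyD_le hΩ i, hΩ.diag_le_trace i]

/-- Extracting `det ^ 2` leaves the exponents `δ_i / 2 - 2`, nonnegative because `δ_i > 4`. This
gives vanishing of second order at the boundary of the cone. -/
theorem wishartDensity_le_det_sq_mul (hδ : ∀ k, 4 < δ k) {c : ℝ}
    (hc : ∀ Ω : Matrix (Fin p) (Fin p) ℝ, Ω.PosSemidef → c * Ω.trace ≤ (Ω * U).trace)
    {Ω : Matrix (Fin p) (Fin p) ℝ} (hΩ : Ω.PosDef) :
    wishartDensity U δ Ω ≤ Ω.det ^ 2 * ((1 + Ω.trace) ^ (∑ i, (δ i / 2 - 2)) *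
      Real.exp (-(c / 2 * Ω.trace))) := by
  have h1 : ∏ i, choleskyD Ω i ^ (δ i / 2) =
      Ω.det ^ 2 * ∏ i, choleskyD Ω i ^ (δ i / 2 - 2) := by
    rw [hΩ.det_eq_prod_choleskyD, ← Finset.prod_pow, ← Finset.prod_mul_distrib]
    refine Finset.prod_congr rfl fun i _ => ?_
    rw [← Real.rpow_natCast, ← Real.rpow_add (choleskyD_pos hΩ i)]
    congr 1
    push_cast
    ring
  rw [wishartDensity, h1, mul_assoc]
  refine mul_le_mul_of_nonneg_left ?_ (sq_nonneg _)
  have hT := hΩ.posSemidef.trace_nonneg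
  refine mul_le_mul (prod_choleskyD_rpow_le hΩ fun i => by linarith [hδ i])
    (Real.exp_le_exp.2 ?_) (Real.exp_pos _).le (by positivity)
  linarith [hc Ω hΩ.posSemidef]

theorem wishartDensity_le_mul_exp (hδ : ∀ k, 4 < δ k) {c : ℝ}
    (hc : ∀ Ω : Matrix (Fin p) (Fin p) ℝ, Ω.PosSemidef → c * Ω.trace ≤ (Ω * U).trace)
    {Ω : Matrix (Fin p) (Fin p) ℝ} (hΩ : Ω.PosDef) :
    wishartDensity U δ Ω ≤ (1 + Ω.trace) ^ (∑ i, δ i / 2) * Real.exp (-(c / 2 * Ω.trace)) := by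
  have hT := hΩ.posSemidef.trace_nonneg
  refine mul_le_mul (prod_choleskyD_rpow_le hΩ fun i => by linarith [hδ i])
    (Real.exp_le_exp.2 ?_) (Real.exp_pos _).le (by positivity)
  linarith [hc Ω hΩ.posSemidef]

theorem abs_paddedInv_le {Ω : Matrix (Fin p) (Fin p) ℝ} (hΩ : Ω.PosDef) (k i j : Fin p) :
    |paddedInv Ω k i j| ≤ (leadingSub Ω k).det⁻¹ *
      ((Fintype.card {i : Fin p // i ≤ k}).factorial *
        (1 + Ω.trace) ^ (Fintype.card {i : Fin p // i ≤ k} : ℝ)) := by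
  have hT := hΩ.posSemidef.trace_nonneg
  have hdet := (hΩ.leadingSub k).det_pos
  simp only [paddedInv, Matrix.of_apply]
  split_ifs with h
  · rw [Matrix.inv_def, Ring.inverse_eq_inv', Matrix.smul_apply, smul_eq_mul, abs_mul,
      abs_of_pos (inv_pos.2 hdet), Real.rpow_natCast]
    refine mul_le_mul_of_nonneg_left ?_ (inv_pos.2 hdet).le
    refine abs_adjugate_le (by linarith) (fun a b => ?_) _ _
    have := hΩ.abs_apply_le_trace a b
    simp only [leadingSub, Matrix.submatrix_apply]
    linarith
  · rw [abs_zero]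
    positivity

/-- The factor `det (Ω_k)⁻¹` from Cramer's rule cancels against one factor `D_l` for each `l ≤ k`,
which the density can spare. -/
theorem abs_wishartDensity_mul_paddedInv_le (hδ : ∀ k, 4 < δ k) {c : ℝ}
    (hc : ∀ Ω : Matrix (Fin p) (Fin p) ℝ, Ω.PosSemidef → c * Ω.trace ≤ (Ω * U).trace)
    (k i j : Fin p) {Ω : Matrix (Fin p) (Fin p) ℝ} (hΩ : Ω.PosDef) :
    |wishartDensity U δ Ω * paddedInv Ω k i j| ≤
      (Fintype.card {i : Fin p // i ≤ k}).factorial *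
        (1 + Ω.trace) ^ ((∑ l, (δ l / 2 - if l ≤ k then 1 else 0)) +
          (Fintype.card {i : Fin p // i ≤ k} : ℝ)) * Real.exp (-(c / 2 * Ω.trace)) := by
  have hT := hΩ.posSemidef.trace_nonneg
  have hdet := (hΩ.leadingSub k).det_pos
  rw [abs_mul, abs_of_pos (wishartDensity_pos U δ hΩ)]
  refine (mul_le_mul_of_nonneg_left (abs_paddedInv_le hΩ k i j)
    (wishartDensity_pos U δ hΩ).le).trans ?_
  have h1 : ∏ l, choleskyD Ω l ^ (δ l / 2) = (leadingSub Ω k).det *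
      ∏ l, choleskyD Ω l ^ (δ l / 2 - if l ≤ k then 1 else 0) := by
    rw [hΩ.det_leadingSub, ← Finset.prod_mul_distrib]
    refine Finset.prod_congr rfl fun l _ => ?_
    split_ifs
    · rw [Real.rpow_sub_one (choleskyD_pos hΩ l).ne']
      field_simp [(choleskyD_pos hΩ l).ne']
    · rw [sub_zero, one_mul]
  have h2 : ∏ l, choleskyD Ω l ^ (δ l / 2 - if l ≤ k then 1 else 0) ≤ _ :=
    prod_choleskyD_rpow_le hΩ fun l => by
      have := hδ l
      split_ifs <;> linarith
  have h3 : Real.exp (-(1 / 2) * (Ω * U).trace) ≤ Real.exp (-(c / 2 * Ω.trace)) :=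
    Real.exp_le_exp.2 (by linarith [hc Ω hΩ.posSemidef])
  rw [wishartDensity, h1, Real.rpow_add (by positivity)]
  set P := ∏ l, choleskyD Ω l ^ (δ l / 2 - if l ≤ k then 1 else 0)
  set Q := (1 + Ω.trace) ^ ∑ l, (δ l / 2 - if l ≤ k then 1 else 0)
  set R := (1 + Ω.trace) ^ (Fintype.card {i : Fin p // i ≤ k} : ℝ)
  have hR : 0 ≤ R := by positivity
  have hQ : 0 ≤ Q := by positivity
  have hm : (0 : ℝ) ≤ ((Fintype.card {i : Fin p // i ≤ k}).factorial : ℕ) := Nat.cast_nonneg _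
  generalize (((Fintype.card {i : Fin p // i ≤ k}).factorial : ℕ) : ℝ) = m at hm ⊢
  calc (leadingSub Ω k).det * P * Real.exp (-(1 / 2) * (Ω * U).trace) *
        ((leadingSub Ω k).det⁻¹ * (m * R))
      = (P * Real.exp (-(1 / 2) * (Ω * U).trace)) * (m * R) := by field_simp
    _ ≤ (Q * Real.exp (-(c / 2 * Ω.trace))) * (m * R) :=
        mul_le_mul_of_nonneg_right (mul_le_mul h2 h3 (Real.exp_pos _).le hQ) (by positivity)
    _ = _ := by ring

theorem integrable_coneDensity (hU : U.PosDef) (hδ : ∀ k, 4 < δ k) :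
    Integrable (coneDensity H U δ) := by
  obtain ⟨c, hc, h⟩ := exists_pos_mul_trace_le_trace_mul hU
  refine integrable_of_abs_le_trace H (measurable_coneDensity H U δ)
    (fun x hx => coneDensity_of_not_posDef H U δ hx) (K := 1) (N := ∑ i, δ i / 2)
    (half_pos hc) (Finset.sum_nonneg fun i _ => by linarith [hδ i]) fun x hx => ?_
  rw [abs_of_nonneg (coneDensity_nonneg H U δ x), coneDensity_of_posDef H U δ hx, one_mul]
  exact wishartDensity_le_mul_exp hδ h hx

theorem integrable_coneDensity_mul_sigmaStar (hU : U.PosDef) (hδ : ∀ k, 4 < δ k) (i j : Fin p) :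
    Integrable fun x => coneDensity H U δ x * sigmaStar δ (ofFree H x) i j := by
  obtain ⟨c, hc, h⟩ := exists_pos_mul_trace_le_trace_mul hU
  have h1 : ∀ k, Integrable fun x => coneDensity H U δ x * paddedInv (ofFree H x) k i j := by
    intro k
    refine integrable_of_abs_le_trace H
      (K := ((Fintype.card {i : Fin p // i ≤ k}).factorial : ℕ))
      (N := (∑ l, (δ l / 2 - if l ≤ k then 1 else 0)) + (Fintype.card {i : Fin p // i ≤ k} : ℝ))
      ?_ (fun x hx => ?_) (half_pos hc) ?_ fun x hx => ?_
    · exact (measurable_coneDensity H U δ).mul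
        ((measurable_paddedInv_apply k i j).comp (measurable_ofFree H))
    · rw [coneDensity_of_not_posDef H U δ hx, zero_mul]
    · refine add_nonneg (Finset.sum_nonneg fun l _ => ?_) (Nat.cast_nonneg _)
      have := hδ l
      split_ifs <;> linarith
    · rw [coneDensity_of_posDef H U δ hx]
      exact abs_wishartDensity_mul_paddedInv_le hδ h k i j hx
  have h2 : (fun x => coneDensity H U δ x * sigmaStar δ (ofFree H x) i j) = fun x =>
      ∑ k, (δ k - nextShape δ k) * (coneDensity H U δ x * paddedInv (ofFree H x) k i j) := by
    funext x
    simp only [sigmaStar, Matrix.sum_apply, Matrix.smul_apply, smul_eq_mul, Finset.mul_sum]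
    exact Finset.sum_congr rfl fun k _ => by ring
  rw [h2]
  exact integrable_finsetSum _ fun k _ => (h1 k).const_mul _

theorem exists_coneDensity_le_det_sq (hU : U.PosDef) (hδ : ∀ k, 4 < δ k) :
    ∃ K, ∀ x, coneDensity H U δ x ≤ K * (ofFree H x).det ^ 2 := by
  obtain ⟨c, hc, h⟩ := exists_pos_mul_trace_le_trace_mul hU
  obtain ⟨M, hM⟩ := exists_one_add_rpow_le_mul_exp (half_pos hc)
    (N := ∑ i, (δ i / 2 - 2)) (Finset.sum_nonneg fun i _ => by linarith [hδ i])
  have hM0 : 0 ≤ M := by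
    have := hM 0 le_rfl
    simp at this
    linarith
  refine ⟨M, fun x => ?_⟩
  by_cases hx : (ofFree H x).PosDef
  · rw [coneDensity_of_posDef H U δ hx, mul_comm]
    refine (wishartDensity_le_det_sq_mul hδ h hx).trans
      (mul_le_mul_of_nonneg_left ?_ (sq_nonneg _))
    rw [Real.exp_neg, ← div_eq_mul_inv, div_le_iff₀ (Real.exp_pos _)]
    exact hM _ hx.posSemidef.trace_nonneg
  · rw [coneDensity_of_not_posDef H U δ hx]
    positivity

theorem integral_coneDensity_pos (hU : U.PosDef) (hδ : ∀ k, 4 < δ k) :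
    0 < ∫ x, coneDensity H U δ x := by
  rw [integral_pos_iff_support_of_nonneg (coneDensity_nonneg H U δ)
    (integrable_coneDensity H hU hδ)]
  have h : Function.support (coneDensity H U δ) = {x | (ofFree H x).PosDef} := by
    ext x
    by_cases hx : (ofFree H x).PosDef
    · simp [hx, coneDensity_of_posDef H U δ hx, (wishartDensity_pos U δ hx).ne']
    · simp [hx, coneDensity_of_not_posDef H U δ hx]
  rw [h]
  refine (isOpen_setOf_posDef_ofFree H).measure_pos _ ?_
  obtain ⟨x, hx⟩ := exists_ofFree_eq_one H
  exact ⟨x, by simpa [hx] using Matrix.PosDef.one⟩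

end ConeDensity

/-! ### Differentiation and integration by parts -/

/-- Zero padding confines the trace to the leading indices; logarithmic derivatives of all minors
become pairings of `E` with `p × p` matrices. -/
theorem trace_inv_leadingSub_mul_leadingSub {p : ℕ} (Ω E : Matrix (Fin p) (Fin p) ℝ) (k : Fin p) :
    ((leadingSub Ω k)⁻¹ * leadingSub E k).trace = (E * paddedInv Ω k).trace := by
  have hsum : ∀ f : Fin p → ℝ, (∀ i, ¬ i ≤ k → f i = 0) →
      ∑ i, f i = ∑ i : {i : Fin p // i ≤ k}, f i := by
    intro f hf
    rw [← Finset.sum_subset (Finset.filter_subset (· ≤ k) Finset.univ)]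
    · exact Finset.sum_subtype _ (by simp) f
    · intro i _ hi
      exact hf i (by simpa using hi)
  rw [Matrix.trace_mul_comm]
  simp only [Matrix.trace, Matrix.diag_apply, Matrix.mul_apply]
  rw [hsum]
  · refine Finset.sum_congr rfl fun i _ => ?_
    rw [hsum]
    · refine Finset.sum_congr rfl fun j _ => ?_
      simp only [leadingSub, Matrix.submatrix_apply, paddedInv, Matrix.of_apply]
      rw [dif_pos ⟨j.2, i.2⟩]
    · intro j hj
      simp [paddedInv, hj]
  · intro i hi
    simp [paddedInv, hi]

theorem trace_mul_sigmaStar {p : ℕ} (δ : Fin p → ℝ) (Ω E : Matrix (Fin p) (Fin p) ℝ) :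
    (E * sigmaStar δ Ω).trace =
      ∑ k, (δ k - nextShape δ k) * (E * paddedInv Ω k).trace := by
  simp [sigmaStar, Matrix.mul_sum, Matrix.trace_sum]

section LineDeriv

variable {p : ℕ} (H : SimpleGraph (Fin p)) {U : Matrix (Fin p) (Fin p) ℝ} {δ : Fin p → ℝ}

theorem hasLineDerivAt_coneDensity_of_posDef {x : FreePos H → ℝ} (hx : (ofFree H x).PosDef)
    (v : FreePos H → ℝ) :
    HasLineDerivAt ℝ (coneDensity H U δ) (coneDensity H U δ x *
      (1 / 2 * (ofFree H v * (sigmaStar δ (ofFree H x) - U)).trace)) x v := by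
  set A := ofFree H x with hA
  set E := ofFree H v with hE
  have hnear : ∀ᶠ t : ℝ in nhds 0, (A + t • E).PosDef := by
    have hc : Continuous fun t : ℝ => x + t • v := by fun_prop
    have h0 : {x | (ofFree H x).PosDef} ∈ nhds (x + (0 : ℝ) • v) := by
      rw [zero_smul, add_zero]
      exact (isOpen_setOf_posDef_ofFree H).mem_nhds hx
    filter_upwards [hc.continuousAt.eventually_mem h0] with t ht
    rw [hA, hE, ← ofFree_add_smul]
    exact ht
  have hlog : ∀ k, HasDerivAt (fun t : ℝ => Real.log (leadingSub (A + t • E) k).det)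
      ((E * paddedInv A k).trace) 0 := by
    intro k
    have hdet := (hx.leadingSub k).det_pos.ne'
    have h1 := hasDerivAt_det_add_smul (leadingSub A k) (leadingSub E k)
      (isUnit_iff_ne_zero.2 hdet)
    have h2 := h1.log (by simpa using hdet)
    rw [trace_inv_leadingSub_mul_leadingSub] at h2
    simp only [zero_smul, add_zero] at h2
    rw [mul_div_cancel_left₀ _ hdet] at h2
    exact h2
  have htr : HasDerivAt (fun t : ℝ => ((A + t • E) * U).trace) ((E * U).trace) 0 := by
    simp only [Matrix.add_mul, Matrix.smul_mul, Matrix.trace_add, Matrix.trace_smul, smul_eq_mul]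
    simpa using ((hasDerivAt_id (0 : ℝ)).mul_const (E * U).trace).const_add (A * U).trace
  have hexp := ((HasDerivAt.fun_sum fun k (_ : k ∈ Finset.univ) =>
    (hlog k).mul_const ((δ k - nextShape δ k) / 2)).add (htr.const_mul (-(1 / 2)))).exp
  have hval : coneDensity H U δ x *
      (1 / 2 * (E * (sigmaStar δ A - U)).trace) = wishartDensity U δ A * (∑ k, (E * paddedInv A k).trace *
        ((δ k - nextShape δ k) / 2) + -(1 / 2) * (E * U).trace) := by
    rw [coneDensity_of_posDef H U δ hx, Matrix.mul_sub, Matrix.trace_sub, trace_mul_sigmaStar,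
      mul_sub, Finset.mul_sum]
    congr 1
    rw [sub_eq_add_neg, neg_mul]
    congr 1
    exact Finset.sum_congr rfl fun k _ => by ring
  rw [HasLineDerivAt, hval]
  have h0 : wishartDensity U δ A = Real.exp (∑ k, Real.log (leadingSub (A + (0 : ℝ) • E) k).det *
      ((δ k - nextShape δ k) / 2) + -(1 / 2) * ((A + (0 : ℝ) • E) * U).trace) := by
    rw [zero_smul, add_zero]
    exact hx.wishartDensity_eq U δ
  rw [h0]
  refine hexp.congr_of_eventuallyEq ?_
  filter_upwards [hnear] with t ht
  have ht' : (ofFree H (x + t • v)).PosDef := by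
    rw [ofFree_add_smul]
    exact ht
  rw [coneDensity_of_posDef H U δ ht', ofFree_add_smul]
  exact ht.wishartDensity_eq U δ

/-- At a singular semidefinite point, `0 ≤ f ≤ K * det ^ 2` along the line, and `det` is
differentiable and vanishes at `t = 0`, so `f = o(t)`. Off the closed semidefinite cone, `f` is
locally zero. -/
theorem hasLineDerivAt_coneDensity_of_not_posDef (hU : U.PosDef) (hδ : ∀ k, 4 < δ k)
    {x : FreePos H → ℝ} (hx : ¬ (ofFree H x).PosDef) (v : FreePos H → ℝ) :
    HasLineDerivAt ℝ (coneDensity H U δ) 0 x v := by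
  by_cases hpsd : (ofFree H x).PosSemidef
  · have hdet : (ofFree H x).det = 0 := by
      by_contra h
      exact hx (hpsd.posDef_iff_det_ne_zero.2 h)
    obtain ⟨K, hK⟩ := exists_coneDensity_le_det_sq H hU hδ
    have hdiff : DifferentiableAt ℝ (fun t : ℝ => (ofFree H (x + t • v)).det) 0 := by
      simp only [ofFree_add_smul, Matrix.det_apply, Matrix.add_apply, Matrix.smul_apply]
      fun_prop
    have hsq := ((hdiff.hasDerivAt.pow 2).const_mul K).isLittleO
    simp [hdet] at hsq
    rw [HasLineDerivAt, hasDerivAt_iff_isLittleO_nhds_zero]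
    refine Asymptotics.IsBigO.trans_isLittleO (.of_bound 1 (.of_forall fun t => ?_)) hsq
    simp only [zero_add, zero_smul, add_zero, smul_zero, sub_zero,
      coneDensity_of_not_posDef H U δ hx, one_mul]
    rw [Real.norm_of_nonneg (coneDensity_nonneg H U δ _)]
    exact (hK _).trans (le_abs_self _)
  · have hopen : IsOpen {y | ¬ (ofFree H y).PosSemidef} :=
      (isClosed_setOf_posSemidef.preimage (continuous_ofFree H)).isOpen_compl
    have hc : Continuous fun t : ℝ => x + t • v := by fun_prop
    have h0 : {y | ¬ (ofFree H y).PosSemidef} ∈ nhds (x + (0 : ℝ) • v) := by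
      rw [zero_smul, add_zero]
      exact hopen.mem_nhds hpsd
    refine (hasDerivAt_const (0 : ℝ) (0 : ℝ)).congr_of_eventuallyEq ?_
    filter_upwards [hc.continuousAt.eventually_mem h0] with t ht
    exact coneDensity_of_not_posDef H U δ fun h => ht h.posSemidef

theorem hasLineDerivAt_coneDensity (hU : U.PosDef) (hδ : ∀ k, 4 < δ k) (x v : FreePos H → ℝ) :
    HasLineDerivAt ℝ (coneDensity H U δ) (coneDensity H U δ x *
      (1 / 2 * (ofFree H v * (sigmaStar δ (ofFree H x) - U)).trace)) x v := by
  by_cases hx : (ofFree H x).PosDef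
  · exact hasLineDerivAt_coneDensity_of_posDef H hx v
  · rw [coneDensity_of_not_posDef H U δ hx, zero_mul]
    exact hasLineDerivAt_coneDensity_of_not_posDef H hU hδ hx v

end LineDeriv

/-- Integration by parts against the constant `1`; only the products with `1` need be integrable. -/
theorem integral_eq_zero_of_hasLineDerivAt {E : Type*} [NormedAddCommGroup E] [NormedSpace ℝ E]
    [FiniteDimensional ℝ E] [MeasurableSpace E] [BorelSpace E] {μ : Measure E}
    [μ.IsAddHaarMeasure] {f f' : E → ℝ} {v : E} (hf : Integrable f μ) (hf' : Integrable f' μ)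
    (h : ∀ x, HasLineDerivAt ℝ f (f' x) x v) : ∫ x, f' x ∂μ = 0 := by
  have := integral_bilinear_hasLineDerivAt_right_eq_neg_left_of_integrable (μ := μ)
    (f := fun _ : E => (1 : ℝ)) (f' := fun _ => 0) (g := f) (g' := f') (v := v)
    (B := ContinuousLinearMap.mul ℝ ℝ) (by simp) (by simpa using hf') (by simpa using hf)
    (fun x _ => hasDerivAt_const (0 : ℝ) (1 : ℝ)) (fun x _ => h x)
  simpa using this

theorem trace_mul_eq_sum {p : ℕ} (A B : Matrix (Fin p) (Fin p) ℝ) :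
    (A * B).trace = ∑ i, ∑ j, A i j * B j i := by
  simp [Matrix.trace, Matrix.mul_apply]

section Moments

variable {p : ℕ} (H : SimpleGraph (Fin p)) {U : Matrix (Fin p) (Fin p) ℝ} {δ : Fin p → ℝ}

theorem integrable_coneDensity_mul_sub (hU : U.PosDef) (hδ : ∀ k, 4 < δ k) (i j : Fin p) :
    Integrable fun x => coneDensity H U δ x * (sigmaStar δ (ofFree H x) - U) i j := by
  simp only [Matrix.sub_apply, mul_sub]
  exact (integrable_coneDensity_mul_sigmaStar H hU hδ i j).sub
    ((integrable_coneDensity H hU hδ).mul_const _)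

theorem sigmaStar_apply_comm {Ω : Matrix (Fin p) (Fin p) ℝ} (hΩ : Ω.IsHermitian) (i j : Fin p) :
    sigmaStar δ Ω i j = sigmaStar δ Ω j i := by
  simp only [sigmaStar, Matrix.sum_apply, Matrix.smul_apply]
  refine Finset.sum_congr rfl fun k _ => ?_
  congr 1
  simp only [paddedInv, Matrix.of_apply]
  have hs : (leadingSub Ω k)⁻¹.IsHermitian := (hΩ.submatrix _).inv
  by_cases h : i ≤ k ∧ j ≤ k
  · rw [dif_pos h, dif_pos h.symm]
    simpa using hs.apply ⟨j, h.2⟩ ⟨i, h.1⟩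
  · rw [dif_neg h, dif_neg fun h' => h h'.symm]

/-- The score of the density has mean zero in every direction, so that the projection of
`sigmaStar` has mean `U`. -/
theorem integral_coneDensity_mul_sigmaStar (hU : U.PosDef) (hδ : ∀ k, 4 < δ k) {i j : Fin p}
    (hij : i = j ∨ H.Adj i j) :
    ∫ x, coneDensity H U δ x * sigmaStar δ (ofFree H x) i j =
      (∫ x, coneDensity H U δ x) * U i j := by
  have hUs : ∀ i j, U i j = U j i := fun i j => by simpa using hU.isHermitian.apply j i
  -- `M` is `E[Σ*] - U` up to the normalizing constant.
  set M : Matrix (Fin p) (Fin p) ℝ := Matrix.of fun i j =>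
    ∫ x, coneDensity H U δ x * (sigmaStar δ (ofFree H x) - U) i j with hM
  have hMs : ∀ i j, M i j = M j i := by
    intro i j
    simp only [hM, Matrix.of_apply, Matrix.sub_apply]
    refine integral_congr_ae (.of_forall fun x => ?_)
    beta_reduce
    rw [sigmaStar_apply_comm (isHermitian_ofFree H x) i j, hUs i j]
  have hzero : ∀ v, (ofFree H v * M).trace = 0 := by
    intro v
    have hexp : ∀ x, coneDensity H U δ x *
        (1 / 2 * (ofFree H v * (sigmaStar δ (ofFree H x) - U)).trace) =
        ∑ i, ∑ j, 1 / 2 * ofFree H v i j *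
          (coneDensity H U δ x * (sigmaStar δ (ofFree H x) - U) j i) := by
      intro x
      rw [trace_mul_eq_sum]
      simp only [Finset.mul_sum]
      exact Finset.sum_congr rfl fun i _ => Finset.sum_congr rfl fun j _ => by ring
    have hint : ∀ i j, Integrable fun x => 1 / 2 * ofFree H v i j *
        (coneDensity H U δ x * (sigmaStar δ (ofFree H x) - U) j i) :=
      fun i j => (integrable_coneDensity_mul_sub H hU hδ j i).const_mul _
    have h1 := integral_eq_zero_of_hasLineDerivAt (μ := volume)
      (f := coneDensity H U δ) (v := v) (integrable_coneDensity H hU hδ)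
      (f' := fun x => coneDensity H U δ x *
        (1 / 2 * (ofFree H v * (sigmaStar δ (ofFree H x) - U)).trace))
      (by
        simp only [hexp]
        exact integrable_finsetSum _ fun i _ => integrable_finsetSum _ fun j _ => hint i j)
      fun x => hasLineDerivAt_coneDensity H hU hδ x v
    simp only [hexp] at h1
    rw [integral_finsetSum _ fun i _ => integrable_finsetSum _ fun j _ => hint i j] at h1
    simp only [integral_finsetSum _ fun j _ => hint _ j, integral_const_mul] at h1
    rw [trace_mul_eq_sum]
    simp only [mul_assoc, ← Finset.mul_sum] at h1
    exact (mul_eq_zero.1 h1).resolve_left (by norm_num)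
  have h2 := congrFun (congrFun (graphPart_eq_zero_of_trace_ofFree_mul_eq_zero H hMs hzero) i) j
  simp only [graphPart, Matrix.of_apply, if_pos hij, hM, Matrix.sub_apply, mul_sub,
    Matrix.zero_apply] at h2
  rw [integral_sub (integrable_coneDensity_mul_sigmaStar H hU hδ i j)
    ((integrable_coneDensity H hU hδ).mul_const _), integral_mul_const] at h2
  linarith

end Moments

/-! ### The generalized G-Wishart distribution in free entries -/

section Law

variable {p : ℕ} (H : SimpleGraph (Fin p)) {U : Matrix (Fin p) (Fin p) ℝ} {δ : Fin p → ℝ}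

theorem wishartMeasure_eq_map (U : Matrix (Fin p) (Fin p) ℝ) (δ : Fin p → ℝ) :
    wishartMeasure H U δ =
      (volume.withDensity fun x => ENNReal.ofReal (coneDensity H U δ x)).map (ofFree H) := by
  -- A function measurable on all matrices that equals the density on the cone; the change of
  -- variables needs this measurability.
  set g : Matrix (Fin p) (Fin p) ℝ → ℝ := fun Ω => Real.exp (∑ k,
    Real.log (leadingSub Ω k).det * ((δ k - nextShape δ k) / 2) + -(1 / 2) * (Ω * U).trace)
    with hg
  have hgm : Measurable g := by
    refine Real.measurable_exp.comp (Measurable.add ?_ ?_)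
    · exact Finset.measurable_sum _ fun k _ =>
        (Real.measurable_log.comp (continuous_det_leadingSub k).measurable).mul_const _
    · exact (Continuous.matrix_trace
        (continuous_id.matrix_mul continuous_const)).measurable.const_mul _
  have h1 : wishartMeasure H U δ = ((freeLebesgue H).restrict (PDCone H)).withDensity
      fun Ω => ENNReal.ofReal (g Ω) := by
    refine withDensity_congr_ae ?_
    filter_upwards [ae_restrict_mem (measurableSet_PDCone H)] with Ω hΩ
    rw [hΩ.1.wishartDensity_eq]
  have hm := measurable_ofFree H
  rw [h1]
  ext s hs
  rw [withDensity_apply _ hs, Measure.restrict_restrict hs, freeLebesgue,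
    setLIntegral_map (hs.inter (measurableSet_PDCone H)) hgm.ennreal_ofReal hm,
    Measure.map_apply hm hs, withDensity_apply _ (hm hs),
    ← lintegral_indicator (hm (hs.inter (measurableSet_PDCone H))),
    ← lintegral_indicator (hm hs)]
  refine lintegral_congr fun x => ?_
  by_cases hx : (ofFree H x).PosDef
  · have hx' := (ofFree_mem_PDCone_iff H x).2 hx
    by_cases hxs : ofFree H x ∈ s
    · rw [Set.indicator_of_mem (show x ∈ ofFree H ⁻¹' (s ∩ PDCone H) from ⟨hxs, hx'⟩),
        Set.indicator_of_mem (show x ∈ ofFree H ⁻¹' s from hxs), coneDensity_of_posDef H U δ hx,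
        hx.wishartDensity_eq]
    · rw [Set.indicator_of_notMem (show x ∉ ofFree H ⁻¹' (s ∩ PDCone H) from fun h => hxs h.1),
        Set.indicator_of_notMem (show x ∉ ofFree H ⁻¹' s from hxs)]
  · have hx' := mt (ofFree_mem_PDCone_iff H x).1 hx
    rw [Set.indicator_of_notMem (show x ∉ ofFree H ⁻¹' (s ∩ PDCone H) from fun h => hx' h.2)]
    by_cases hxs : ofFree H x ∈ s
    · rw [Set.indicator_of_mem (show x ∈ ofFree H ⁻¹' s from hxs),
        coneDensity_of_not_posDef H U δ hx, ENNReal.ofReal_zero]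
    · rw [Set.indicator_of_notMem (show x ∉ ofFree H ⁻¹' s from hxs)]

theorem wishartMeasure_univ (hU : U.PosDef) (hδ : ∀ k, 4 < δ k) :
    wishartMeasure H U δ Set.univ = ENNReal.ofReal (∫ x, coneDensity H U δ x) := by
  rw [wishartMeasure_eq_map, Measure.map_apply (measurable_ofFree H) MeasurableSet.univ,
    Set.preimage_univ, withDensity_apply _ MeasurableSet.univ, Measure.restrict_univ,
    ofReal_integral_eq_lintegral_ofReal (integrable_coneDensity H hU hδ)
      (.of_forall (coneDensity_nonneg H U δ))]

theorem isProbabilityMeasure_genGWishart (hU : U.PosDef) (hδ : ∀ k, 4 < δ k) :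
    IsProbabilityMeasure (genGWishart H U δ) := by
  constructor
  rw [genGWishart, Measure.smul_apply, smul_eq_mul, wishartMeasure_univ H hU hδ]
  exact ENNReal.inv_mul_cancel
    (ENNReal.ofReal_pos.2 (integral_coneDensity_pos H hU hδ)).ne' ENNReal.ofReal_ne_top

theorem integrable_genGWishart (hU : U.PosDef) (hδ : ∀ k, 4 < δ k)
    {φ : Matrix (Fin p) (Fin p) ℝ → ℝ} (hφ : Measurable φ)
    (hint : Integrable fun x => coneDensity H U δ x * φ (ofFree H x)) :
    Integrable φ (genGWishart H U δ) := by
  refine Integrable.smul_measure ?_ (ENNReal.inv_ne_top.2 ?_)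
  · rw [wishartMeasure_eq_map, integrable_map_measure hφ.aestronglyMeasurable
      (measurable_ofFree H).aemeasurable, integrable_withDensity_iff_integrable_smul'
      (measurable_coneDensity H U δ).ennreal_ofReal (.of_forall fun _ => ENNReal.ofReal_lt_top)]
    refine hint.congr (.of_forall fun x => ?_)
    simp [ENNReal.toReal_ofReal (coneDensity_nonneg H U δ x)]
  · rw [wishartMeasure_univ H hU hδ]
    exact (ENNReal.ofReal_pos.2 (integral_coneDensity_pos H hU hδ)).ne'

theorem integral_genGWishart (hU : U.PosDef) (hδ : ∀ k, 4 < δ k)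
    {φ : Matrix (Fin p) (Fin p) ℝ → ℝ} (hφ : Measurable φ) :
    ∫ Ω, φ Ω ∂genGWishart H U δ =
      (∫ x, coneDensity H U δ x)⁻¹ * ∫ x, coneDensity H U δ x * φ (ofFree H x) := by
  rw [genGWishart, integral_smul_measure, wishartMeasure_univ H hU hδ, ENNReal.toReal_inv,
    ENNReal.toReal_ofReal (integral_coneDensity_pos H hU hδ).le, smul_eq_mul]
  congr 1
  rw [wishartMeasure_eq_map, integral_map (measurable_ofFree H).aemeasurable
    hφ.aestronglyMeasurable, integral_withDensity_eq_integral_toReal_smul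
    (measurable_coneDensity H U δ).ennreal_ofReal (.of_forall fun _ => ENNReal.ofReal_lt_top)]
  refine integral_congr_ae (.of_forall fun x => ?_)
  simp [ENNReal.toReal_ofReal (coneDensity_nonneg H U δ x)]

end Law

/-- All differences vanish except the last, which is `d - 0`, and the last leading block is the
whole matrix. The matrix may be singular. -/
theorem sigmaStar_of_const {p : ℕ} {δ : Fin p → ℝ} {d : ℝ} (hd : ∀ k, δ k = d)
    (Ω : Matrix (Fin p) (Fin p) ℝ) (i j : Fin p) : sigmaStar δ Ω i j = d * Ω⁻¹ i j := by
  obtain ⟨n, rfl⟩ : ∃ n, p = n + 1 := ⟨p - 1, by have := i.2; omega⟩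
  have hlast : nextShape δ (Fin.last n) = 0 := by simp [nextShape]
  have hnext : ∀ k, k ≠ Fin.last n → nextShape δ k = d := by
    intro k hk
    have : (k : ℕ) + 1 < n + 1 := by
      have := Fin.val_lt_last hk
      omega
    rw [nextShape, dif_pos this, hd]
  rw [sigmaStar, Finset.sum_eq_single (Fin.last n)]
  · rw [hlast, hd, sub_zero, Matrix.smul_apply, smul_eq_mul]
    congr 1
    simp only [paddedInv, Matrix.of_apply]
    rw [dif_pos ⟨Fin.le_last i, Fin.le_last j⟩]
    have h := Matrix.inv_submatrix_equiv Ω (Equiv.subtypeUnivEquiv fun k => Fin.le_last k)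
      (Equiv.subtypeUnivEquiv fun k => Fin.le_last k)
    exact congrFun (congrFun h ⟨i, Fin.le_last i⟩) ⟨j, Fin.le_last j⟩
  · intro k _ hk
    rw [hnext k hk, hd, sub_self, zero_smul]
  · simp

theorem mainTheorem4 {V : Type*} (G : SimpleGraph V) {p : ℕ} (σ : V ≃ Fin p)
    (U : Matrix (Fin p) (Fin p) ℝ) (hU : U.PosDef)
    (δ : Fin p → ℝ) (hδ : ∀ k, 4 < δ k)
    {S : Type*} [MeasurableSpace S] (P : Measure S)
    (Ω : S → Matrix (Fin p) (Fin p) ℝ)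
    (hΩ : HasLaw Ω (genGWishart (orderedGraph G σ) U δ) P) :
    IsProbabilityMeasure (genGWishart (orderedGraph G σ) U δ) ∧
    (∀ i j, Integrable (fun s => sigmaStar δ (Ω s) i j) P) ∧
    graphPart (orderedGraph G σ) (matrixExpectation P fun s => sigmaStar δ (Ω s)) =
      graphPart (orderedGraph G σ) U ∧
    ∀ d : ℝ, (∀ k, δ k = d) →
      ∀ i j, i = j ∨ (orderedGraph G σ).Adj i j →
        Integrable (fun s => (Ω s)⁻¹ i j) P ∧ ∫ s, (Ω s)⁻¹ i j ∂P = U i j / d := by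
  set H := orderedGraph G σ
  have hm := measurable_sigmaStar_apply δ
  have hint : ∀ i j, Integrable (fun A => sigmaStar δ A i j) (genGWishart H U δ) := fun i j =>
    integrable_genGWishart H hU hδ (hm i j) (integrable_coneDensity_mul_sigmaStar H hU hδ i j)
  have hintP : ∀ i j, Integrable (fun s => sigmaStar δ (Ω s) i j) P := fun i j =>
    ((integrable_map_measure (hm i j).aestronglyMeasurable hΩ.aemeasurable).1
      (by rw [hΩ.map_eq]; exact hint i j))
  have hmean : ∀ i j, i = j ∨ H.Adj i j → ∫ s, sigmaStar δ (Ω s) i j ∂P = U i j := by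
    intro i j hij
    have h1 : ∫ s, sigmaStar δ (Ω s) i j ∂P = ∫ A, sigmaStar δ A i j ∂genGWishart H U δ := by
      rw [← hΩ.map_eq, integral_map hΩ.aemeasurable (hm i j).aestronglyMeasurable]
    rw [h1, integral_genGWishart H hU hδ (hm i j), integral_coneDensity_mul_sigmaStar H hU hδ hij,
      inv_mul_cancel_left₀ (integral_coneDensity_pos H hU hδ).ne']
  refine ⟨isProbabilityMeasure_genGWishart H hU hδ, hintP, ?_, fun d hd i j hij => ?_⟩
  · ext i j
    simp only [graphPart, matrixExpectation, Matrix.of_apply]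
    split_ifs with hij
    · exact hmean i j hij
    · rfl
  -- The index `i` shows `p > 0`; for `p = 0` the number `d` would be arbitrary.
  · have hd0 : d ≠ 0 := by
      have := hδ i
      rw [hd i] at this
      linarith
    have h1 : (fun s => (Ω s)⁻¹ i j) = fun s => d⁻¹ * sigmaStar δ (Ω s) i j := by
      funext s
      rw [sigmaStar_of_const hd, inv_mul_cancel_left₀ hd0]
    rw [h1]
    refine ⟨(hintP i j).const_mul _, ?_⟩
    rw [integral_const_mul, hmean i j hij, div_eq_inv_mul]
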